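/- Let $M$ be a smooth ($C^\infty$, boundaryless) manifold of dimension $n\ge 1$. A smooth $p$-form $\omega$ on $M$ is said to have \emph{constant coefficients on a neighbourhood of} a point $x\in M$ if there is a smooth coordinate system $(u^1,\dots,u^n)$ of $M$, defined on an open neighbourhood $U$ of $x$ and centred at $x$ (that is, $u^i(x)=0$ for all $i$), such that all the functions $$\omega\left(\frac{\partial}{\partial u^{i_1}},\dots,\frac{\partial}{\partial u^{i_p}}\right),\qquad 1\le i_1<\dots<i_p\le n,$$ are constant on $U$. Let $\omega$ be a smooth $(n-1)$-form on $M$ and let $x\in M$ be a point with $\omega_x\ne 0$. Then $\omega$ has constant coefficients on a neighbourhood of $x$ if and only if $\omega$ is closed on a neighbourhood of $x$, i.e. $d\omega=0$ on some open neighbourhood of $x$. -/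

import Mathlib

open scoped Manifold ContDiff Topology

noncomputable section

namespace DiffForm

variable {n : ℕ} {M : Type*} [TopologicalSpace M] [ChartedSpace (EuclideanSpace ℝ (Fin n)) M]

/-- A (not necessarily smooth) `p`-form on an `n`-dimensional manifold `M`: an alternating
`p`-linear form on each tangent space. -/
abbrev Form (n : ℕ) (M : Type*) [TopologicalSpace M]
    [ChartedSpace (EuclideanSpace ℝ (Fin n)) M] (p : ℕ) : Type _ :=
  ∀ y : M, TangentSpace (𝓡 n) y [⋀^Fin p]→L[ℝ] ℝ

/-- The local expression of `α` in the chart `φ`, that is, the pull-back of `α` along `φ⁻¹`.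
It is meaningful on `φ.target`. -/
def inChart {p : ℕ} (α : Form n M p) (φ : OpenPartialHomeomorph M (EuclideanSpace ℝ (Fin n))) :
    EuclideanSpace ℝ (Fin n) → EuclideanSpace ℝ (Fin n) [⋀^Fin p]→L[ℝ] ℝ :=
  fun u ↦ (α (φ.symm u)).compContinuousLinearMap (mfderiv (𝓡 n) (𝓡 n) φ.symm u)

/-- `α` is a smooth form: its local expression in every chart of the smooth structure is
smooth. -/
def IsSmooth {p : ℕ} (α : Form n M p) : Prop :=
  ∀ φ ∈ IsManifold.maximalAtlas (𝓡 n) ∞ M, ContDiffOn ℝ ∞ (inChart α φ) φ.target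

/-- The exterior derivative of `α`. At the point `y` it is computed in the preferred chart
around `y` and pulled back to the tangent space at `y`. -/
def extDeriv {p : ℕ} (α : Form n M p) : Form n M (p + 1) :=
  fun y ↦
    (_root_.extDeriv (inChart α (chartAt (EuclideanSpace ℝ (Fin n)) y))
      (chartAt (EuclideanSpace ℝ (Fin n)) y y)).compContinuousLinearMap
      (mfderiv (𝓡 n) (𝓡 n) (chartAt (EuclideanSpace ℝ (Fin n)) y) y)

/-- `α` is closed on a neighbourhood of `x`. -/
def IsClosedNear {p : ℕ} (α : Form n M p) (x : M) : Prop :=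
  ∀ᶠ y in 𝓝 x, extDeriv α y = 0

/-- The coordinate vector `∂/∂uⁱ` of the coordinate system `φ = (u¹, …, uⁿ)`, at the point
`φ⁻¹ u` with coordinates `u`. It is meaningful on `φ.target`. -/
def coordVector (φ : OpenPartialHomeomorph M (EuclideanSpace ℝ (Fin n))) (i : Fin n)
    (u : EuclideanSpace ℝ (Fin n)) : TangentSpace (𝓡 n) (φ.symm u) :=
  mfderiv (𝓡 n) (𝓡 n) φ.symm u (EuclideanSpace.single i (1 : ℝ))

/-- `α` has constant coefficients on a neighbourhood of `x`: there is a smooth coordinate system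
`φ = (u¹, …, uⁿ)` centred at `x` such that all the functions
`α (∂/∂u^{i₁}, …, ∂/∂u^{iₚ})`, `i₁ < ⋯ < iₚ`, are constant on the domain of `φ`. -/
def HasConstCoeffNear {p : ℕ} (α : Form n M p) (x : M) : Prop :=
  ∃ φ ∈ IsManifold.maximalAtlas (𝓡 n) ∞ M, x ∈ φ.source ∧ φ x = 0 ∧
    ∀ I : Fin p ↪o Fin n, ∃ c : ℝ, ∀ u ∈ φ.target,
      α (φ.symm u) (fun k ↦ coordVector φ (I k) u) = c

end DiffForm

end

/-! If the coefficients are constant in some chart, the local expression has zero exterior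
derivative, and vanishing of `extDeriv` does not depend on the chart (`extDeriv_eq_zero_iff`).

Conversely, a form `η` of codegree one is the contraction of the volume form with a unique vector
field `X` (`volForm_curryLeft_dualVector`), smooth and nonzero wherever `η` is. A flow box
(`exists_flow_box`) turns `X` into `∂/∂u⁰`, so `η` becomes `g du¹ ∧ ⋯ ∧ duᵐ`. Closedness now says
`∂g/∂u⁰ = 0`, so `g` depends on the transverse coordinates only. If `m ≥ 1`, replacing `u¹` by a
function `h` independent of `u⁰` with `∂h/∂u¹ = g` absorbs `g`
(`exists_contDiff_transverseForm_comp_eq`). If `m = 0`, the form is a function with zero derivative,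
hence locally constant.

The smooth flow comes from the implicit function theorem applied to the integral equation in the
Banach space of continuous curves; this needs composition with a smooth map to be a smooth operation
on curves (`ContinuousMap.contDiff_postcomp`). -/

/-! ### Local diffeomorphisms and cut-offs. -/

section LocalDiffeo

/-- The inverse function theorem: a smooth map whose derivative at `a` is invertible restricts to a
diffeomorphism between open sets. -/
theorem exists_openPartialHomeomorph_of_contDiffAt {E F : Type*} [NormedAddCommGroup E]
    [NormedSpace ℝ E] [CompleteSpace E] [NormedAddCommGroup F] [NormedSpace ℝ F]
    {f : E → F} {U : Set E} {a : E} (hU : U ∈ 𝓝 a) (hf : ∀ y ∈ U, ContDiffAt ℝ ∞ f y)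
    (f' : E ≃L[ℝ] F) (hf' : HasFDerivAt f (f' : E →L[ℝ] F) a) :
    ∃ e : OpenPartialHomeomorph E F, (e : E → F) = f ∧ a ∈ e.source ∧ e.source ⊆ U ∧
      ∀ z ∈ e.target, ContDiffAt ℝ ∞ e.symm z := by
  have haU : a ∈ U := mem_of_mem_nhds hU
  have hfa := hf a haU
  let e₀ := hfa.toOpenPartialHomeomorph f hf' (by simp)
  have hcont : ContinuousAt (fderiv ℝ f) a :=
    (hfa.fderiv_right (m := 0) (by simp)).continuousAt
  -- Smoothness of the inverse is needed on the whole target, not only at `f a`. Invertibility is an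
  -- open condition on the derivative, so the source can be shrunk to points where it holds.
  have hinv : ∀ᶠ y in 𝓝 a, fderiv ℝ f y ∈
      Set.range (ContinuousLinearEquiv.toContinuousLinearMap : (E ≃L[ℝ] F) → E →L[ℝ] F) := by
    apply hcont.eventually
    rw [hf'.fderiv]
    exact f'.nhds
  obtain ⟨W, hW, hWo, haW⟩ := mem_nhds_iff.1 (Filter.inter_mem hinv hU)
  refine ⟨e₀.restrOpen W hWo, rfl, ⟨hfa.mem_toOpenPartialHomeomorph_source hf' (by simp), haW⟩,
    fun y hy ↦ (hW hy.2).2, fun z hz ↦ ?_⟩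
  have hzs := (e₀.restrOpen W hWo).map_target hz
  obtain ⟨⟨g, hg⟩, hgU⟩ := hW hzs.2
  refine OpenPartialHomeomorph.contDiffAt_symm (f₀' := g) _ hz ?_ (hf _ hgU)
  rw [hg]
  exact ((hf _ hgU).differentiableAt (by simp)).hasFDerivAt

/-- A function which is smooth near a point agrees near this point with a smooth function. -/
theorem exists_contDiff_eventuallyEq {E F : Type*} [NormedAddCommGroup E]
    [NormedSpace ℝ E] [FiniteDimensional ℝ E] [NormedAddCommGroup F] [NormedSpace ℝ F]
    {f : E → F} {a : E} (hf : ∀ᶠ y in 𝓝 a, ContDiffAt ℝ ∞ f y) :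
    ∃ g : E → F, ContDiff ℝ ∞ g ∧ g =ᶠ[𝓝 a] f := by
  obtain ⟨r, hr, hrf⟩ := Metric.eventually_nhds_iff_ball.1 hf
  let χ : ContDiffBump a := ⟨r / 3, r / 2, by positivity, by linarith⟩
  refine ⟨fun y ↦ χ y • f y, contDiff_iff_contDiffAt.2 fun y ↦ ?_, ?_⟩
  · by_cases hy : y ∈ Metric.ball a r
    · exact χ.contDiffAt.smul (hrf y hy)
    · have hy' : y ∈ (Metric.closedBall a (r / 2))ᶜ := by
        simp only [Metric.mem_ball, not_lt, Set.mem_compl_iff, Metric.mem_closedBall, not_le] at *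
        linarith
      have : (fun y ↦ χ y • f y) =ᶠ[𝓝 y] fun _ ↦ 0 := by
        filter_upwards [Metric.isClosed_closedBall.isOpen_compl.mem_nhds hy'] with z hz
        have : χ z = 0 := χ.zero_of_le_dist (by
          simp only [Set.mem_compl_iff, Metric.mem_closedBall, not_le] at hz
          exact hz.le)
        simp [this]
      exact contDiffAt_const.congr_of_eventuallyEq this
  · filter_upwards [χ.eventuallyEq_one] with y hy
    simp [hy]

end LocalDiffeo

/-! ### Smoothness of composition operators on spaces of continuous maps. -/

section Nemytskii

universe u

variable {K : Type*} [TopologicalSpace K] [CompactSpace K]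

/-- The pointwise evaluation of a continuous family of continuous linear maps on a continuous
family of vectors. -/
noncomputable def ContinuousMap.applyCLM (K : Type*) [TopologicalSpace K] [CompactSpace K]
    (E F : Type*) [NormedAddCommGroup E] [NormedSpace ℝ E] [NormedAddCommGroup F]
    [NormedSpace ℝ F] : C(K, E →L[ℝ] F) →L[ℝ] C(K, E) →L[ℝ] C(K, F) :=
  LinearMap.mkContinuous₂ (E := C(K, E →L[ℝ] F)) (F := C(K, E)) (G := C(K, F))
    (σ₁₃ := RingHom.id ℝ) (σ₂₃ := RingHom.id ℝ)
    (LinearMap.mk₂ ℝ (fun (A : C(K, E →L[ℝ] F)) (h : C(K, E)) ↦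
      (⟨fun t ↦ A t (h t), by fun_prop⟩ : C(K, F)))
      (fun _ _ _ ↦ by ext; simp) (fun _ _ _ ↦ by ext; simp)
      (fun _ _ _ ↦ by ext; simp) (fun _ _ _ ↦ by ext; simp)) 1
    (fun A h ↦ by
      refine (ContinuousMap.norm_le _ (by positivity)).2 fun t ↦ ?_
      rw [one_mul]
      exact (A t).le_of_opNorm_le_of_le (A.norm_coe_le_norm t) (h.norm_coe_le_norm t))

/-- The mean value inequality on the segment from `γ t` to `γ t + h t` bounds the remainder. The
bound is uniform in `t` because `γ ↦ f' ∘ γ` is continuous for the sup norm. -/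
theorem ContinuousMap.hasFDerivAt_postcomp {E F : Type*} [NormedAddCommGroup E] [NormedSpace ℝ E]
    [NormedAddCommGroup F] [NormedSpace ℝ F] (f : C(E, F)) (f' : C(E, E →L[ℝ] F))
    (hf : ∀ y, HasFDerivAt f (f' y) y) (γ : C(K, E)) :
    HasFDerivAt (fun γ : C(K, E) ↦ f.comp γ) (applyCLM K E F (f'.comp γ)) γ := by
  rw [hasFDerivAt_iff_isLittleO_nhds_zero, Asymptotics.isLittleO_iff]
  intro c hc
  have hcont : ContinuousAt (fun γ : C(K, E) ↦ f'.comp γ) γ :=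
    (f'.continuous_postcomp (X := K)).continuousAt
  obtain ⟨δ, hδ, hδc⟩ := (Metric.continuousAt_iff (α := C(K, E)) (β := C(K, E →L[ℝ] F))).1 hcont c hc
  filter_upwards [Metric.ball_mem_nhds 0 hδ] with h hh
  rw [mem_ball_zero_iff] at hh
  refine (ContinuousMap.norm_le _ (by positivity)).2 fun t ↦ ?_
  have key : ∀ z ∈ segment ℝ (γ t) (γ t + h t), ‖f' z - f' (γ t)‖ ≤ c := by
    rw [segment_eq_image']
    rintro _ ⟨s, hs, rfl⟩
    have h1 : dist (γ + s • h) γ < δ := by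
      rw [dist_eq_norm, add_sub_cancel_left, norm_smul, Real.norm_of_nonneg hs.1]
      exact (mul_le_of_le_one_left (norm_nonneg _) hs.2).trans_lt hh
    have h2 := (ContinuousMap.dist_apply_le_dist t).trans (hδc h1).le
    rw [dist_eq_norm] at h2
    simpa using h2
  have := (convex_segment (γ t) (γ t + h t)).norm_image_sub_le_of_norm_hasFDerivWithin_le'
    (fun z _ ↦ (hf z).hasFDerivWithinAt) key (left_mem_segment ..) (right_mem_segment ..)
  simp only [add_sub_cancel_left] at this
  exact this.trans (mul_le_mul_of_nonneg_left (h.norm_coe_le_norm t) hc.le)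

/-- The derivative is built from composition with `fderiv ℝ f`, an operator of the same kind with
values in `E →L[ℝ] F`. Hence the induction quantifies over `F`, and `E` and `F` share a universe. -/
theorem ContinuousMap.contDiff_nat_postcomp {E : Type u} [NormedAddCommGroup E] [NormedSpace ℝ E]
    (k : ℕ) : ∀ {F : Type u} [NormedAddCommGroup F] [NormedSpace ℝ F] (f : C(E, F)),
    ContDiff ℝ ∞ f → ContDiff ℝ k (fun γ : C(K, E) ↦ f.comp γ) := by
  induction k with
  | zero => exact fun f _ ↦ contDiff_zero.2 f.continuous_postcomp
  | succ k ih =>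
    intro F _ _ f hf
    have hf' := contDiff_infty_iff_fderiv.1 hf
    let f' : C(E, E →L[ℝ] F) := ⟨fderiv ℝ f, hf'.2.continuous⟩
    have hA : ContDiff ℝ k (applyCLM K E F) := ContinuousLinearMap.contDiff _
    exact contDiff_succ_iff_hasFDerivAt.2 ⟨fun γ ↦ applyCLM K E F (f'.comp γ),
      hA.comp (ih f' hf'.2),
      hasFDerivAt_postcomp f f' fun y ↦ (hf'.1 y).hasFDerivAt⟩

/-- Composition with a smooth map is a smooth operation on continuous maps. -/
theorem ContinuousMap.contDiff_postcomp {E F : Type u} [NormedAddCommGroup E] [NormedSpace ℝ E]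
    [NormedAddCommGroup F] [NormedSpace ℝ F] (f : C(E, F)) (hf : ContDiff ℝ ∞ f) :
    ContDiff ℝ ∞ (fun γ : C(K, E) ↦ f.comp γ) :=
  contDiff_infty.2 fun k ↦ contDiff_nat_postcomp k f hf

end Nemytskii

/-! ### Smooth local flows and the flow box theorem. -/

section Flow

variable {E : Type*} [NormedAddCommGroup E] [NormedSpace ℝ E]

/-- The indefinite integral `t ↦ ∫₀ᵗ γ` as an operator on curves parametrized by `[-1, 1]`. -/
noncomputable def ContinuousMap.primitiveCLM (E : Type*) [NormedAddCommGroup E] [NormedSpace ℝ E] :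
    C(Set.Icc (-1 : ℝ) 1, E) →L[ℝ] C(Set.Icc (-1 : ℝ) 1, E) :=
  LinearMap.mkContinuous (E := C(Set.Icc (-1 : ℝ) 1, E)) (F := C(Set.Icc (-1 : ℝ) 1, E))
    (σ := RingHom.id ℝ)
    { toFun := fun γ ↦ ⟨fun t ↦ ∫ τ in (0 : ℝ)..t, γ (Set.projIcc (-1) 1 (by norm_num) τ), by
        have : Continuous fun τ : ℝ ↦ γ (Set.projIcc (-1) 1 (by norm_num) τ) :=
          γ.continuous.comp continuous_projIcc
        exact (intervalIntegral.continuous_primitive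
          (fun a b ↦ this.intervalIntegrable a b) 0).comp continuous_subtype_val⟩
      map_add' := fun γ₁ γ₂ ↦ by
        ext t
        exact intervalIntegral.integral_add
          (γ₁.continuous.comp continuous_projIcc).continuousOn.intervalIntegrable
          (γ₂.continuous.comp continuous_projIcc).continuousOn.intervalIntegrable
      map_smul' := fun c γ ↦ by
        ext t
        exact intervalIntegral.integral_smul c _ }
    1 fun γ ↦ by
      refine (ContinuousMap.norm_le _ (by positivity)).2 fun t ↦ ?_
      rw [one_mul]
      refine (intervalIntegral.norm_integral_le_of_norm_le_const
        (fun τ _ ↦ γ.norm_coe_le_norm _)).trans ?_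
      rw [sub_zero]
      exact mul_le_of_le_one_right (norm_nonneg _) (abs_le.2 ⟨t.2.1, t.2.2⟩)

/-- The constant curves. -/
noncomputable def ContinuousMap.constCLM (K : Type*) [TopologicalSpace K] [CompactSpace K]
    (E : Type*) [NormedAddCommGroup E] [NormedSpace ℝ E] : E →L[ℝ] C(K, E) :=
  LinearMap.mkContinuous (F := C(K, E)) (σ := RingHom.id ℝ)
    { toFun := ContinuousMap.const K
      map_add' := fun _ _ ↦ rfl
      map_smul' := fun _ _ ↦ rfl } 1 fun x ↦ by
        refine (ContinuousMap.norm_le _ (by positivity)).2 fun t ↦ ?_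
        rw [one_mul]
        exact le_rfl

/-- Solutions of the integral equation `γ(t) = x + s ∫₀ᵗ f(γ)`, depending smoothly on `(s, x)` and
locally unique. -/
theorem exists_smooth_solution [CompleteSpace E] (f : C(E, E)) (hf : ContDiff ℝ ∞ f) (x₀ : E) :
    ∃ S : ℝ × E → C(Set.Icc (-1 : ℝ) 1, E), ∃ ε > 0,
      (∀ᶠ p in 𝓝 ((0 : ℝ), x₀), ContDiffAt ℝ ∞ S p) ∧
      (∀ᶠ p in 𝓝 ((0 : ℝ), x₀), S p ∈ Metric.ball (ContinuousMap.const _ x₀) ε ∧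
        S p = ContinuousMap.const _ p.2 + p.1 • ContinuousMap.primitiveCLM E (f.comp (S p))) ∧
      ∀ p ∈ Metric.ball ((0 : ℝ), x₀) ε, ∀ γ ∈ Metric.ball (ContinuousMap.const _ x₀) ε,
        γ = ContinuousMap.const _ p.2 + p.1 • ContinuousMap.primitiveCLM E (f.comp γ) →
          γ = S p := by
  let C := C(Set.Icc (-1 : ℝ) 1, E)
  let J : C →L[ℝ] C := ContinuousMap.primitiveCLM E
  let ι : E →L[ℝ] C := ContinuousMap.constCLM _ E
  let Nf : C → C := fun γ ↦ f.comp γ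
  have hNf : ContDiff ℝ ∞ Nf := ContinuousMap.contDiff_postcomp f hf
  -- Solutions are the zeros of `G`. At `s = 0` the nonlinear term has no derivative in `γ`, so the
  -- derivative of `Φ = (p, G)` is the triangular map `(p, γ) ↦ (p, γ - B p)`, inverted by changing
  -- the sign of `B`.
  let G : (ℝ × E) × C → C := fun q ↦ q.2 - ι q.1.2 - q.1.1 • J (Nf q.2)
  have hG : ContDiff ℝ ∞ G := by fun_prop
  let Φ : (ℝ × E) × C → (ℝ × E) × C := fun q ↦ (q.1, G q)
  have hΦ : ContDiff ℝ ∞ Φ := by fun_prop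
  let a : (ℝ × E) × C := ((0, x₀), ι x₀)
  let B : ℝ × E →L[ℝ] C := ι ∘L ContinuousLinearMap.snd ℝ ℝ E +
    (ContinuousLinearMap.fst ℝ ℝ E).smulRight (J (Nf (ι x₀)))
  let Φ' : ((ℝ × E) × C) ≃L[ℝ] (ℝ × E) × C :=
    ContinuousLinearEquiv.equivOfInverse
      ((ContinuousLinearMap.fst ℝ _ _).prod
        (ContinuousLinearMap.snd ℝ _ _ - B ∘L ContinuousLinearMap.fst ℝ _ _))
      ((ContinuousLinearMap.fst ℝ _ _).prod
        (ContinuousLinearMap.snd ℝ _ _ + B ∘L ContinuousLinearMap.fst ℝ _ _))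
      (fun q ↦ by simp) (fun q ↦ by simp)
  have hΦ' : HasFDerivAt Φ (Φ' : ((ℝ × E) × C) →L[ℝ] (ℝ × E) × C) a := by
    have h1 : HasFDerivAt (fun q : (ℝ × E) × C ↦ J (Nf q.2))
        (fderiv ℝ (fun q : (ℝ × E) × C ↦ J (Nf q.2)) a) a :=
      ((show ContDiff ℝ ∞ (fun q : (ℝ × E) × C ↦ J (Nf q.2)) by fun_prop).differentiable
        (by simp) a).hasFDerivAt
    have h2 : HasFDerivAt (fun q : (ℝ × E) × C ↦ q.1.1) _ a :=
      ((ContinuousLinearMap.fst ℝ ℝ E) ∘L (ContinuousLinearMap.fst ℝ _ C)).hasFDerivAt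
    have h3 : HasFDerivAt (fun q : (ℝ × E) × C ↦ q.2 - ι q.1.2) _ a :=
      ((ContinuousLinearMap.snd ℝ _ C) - ι ∘L (ContinuousLinearMap.snd ℝ ℝ E) ∘L
        (ContinuousLinearMap.fst ℝ _ C)).hasFDerivAt
    have h4 := (hasFDerivAt_fst (𝕜 := ℝ) (p := a)).prodMk (h3.sub (h2.smul h1))
    refine h4.congr_fderiv ?_
    ext q <;> simp [Φ', B, a]
  obtain ⟨e, he, hae, -, hes⟩ := exists_openPartialHomeomorph_of_contDiffAt (U := Set.univ)
    Filter.univ_mem (fun _ _ ↦ hΦ.contDiffAt) Φ' hΦ'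
  have hΦa : Φ a = ((0, x₀), 0) := by simp [Φ, G, a]
  let j : ℝ × E → (ℝ × E) × C := fun p ↦ (p, 0)
  have hj : ContDiff ℝ ∞ j := by fun_prop
  have hj0 : j (0, x₀) = e a := by rw [he, hΦa]
  have hjt : ∀ᶠ p in 𝓝 ((0 : ℝ), x₀), j p ∈ e.target := by
    apply hj.continuous.continuousAt.eventually_mem
    rw [hj0]
    exact e.open_target.mem_nhds (e.map_source hae)
  have hsymm : ∀ p, j p ∈ e.target → Φ (e.symm (j p)) = j p := fun p hp ↦ by
    rw [← he]
    exact e.right_inv hp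
  let S : ℝ × E → C := fun p ↦ (e.symm (j p)).2
  have hS : ∀ p, j p ∈ e.target → ContDiffAt ℝ ∞ S p := fun p hp ↦
    contDiffAt_snd.comp p ((hes _ hp).comp p hj.contDiffAt)
  obtain ⟨ε, hε, hεs⟩ := Metric.mem_nhds_iff.1 (e.open_source.mem_nhds hae)
  refine ⟨S, ε, hε, hjt.mono hS, ?_, ?_⟩
  · have h1 : ∀ᶠ p in 𝓝 ((0 : ℝ), x₀), S p ∈ Metric.ball (ι x₀) ε := by
      have hc : ContinuousAt S (0, x₀) := (hS _ hjt.self_of_nhds).continuousAt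
      apply hc.eventually_mem
      have : S (0, x₀) = ι x₀ := by
        simp only [S, hj0, e.left_inv hae, a]
      rw [this]
      exact Metric.ball_mem_nhds _ hε
    filter_upwards [h1, hjt] with p hp1 hp
    refine ⟨hp1, ?_⟩
    have h2 := hsymm p hp
    have h3 : (e.symm (j p)).1 = p := congrArg Prod.fst h2
    have h4 : G (e.symm (j p)) = 0 := congrArg Prod.snd h2
    simp only [G, h3] at h4
    rw [sub_sub, sub_eq_zero] at h4
    exact h4
  · intro p hp γ hγ h
    have h1 : (p, γ) ∈ e.source := by
      apply hεs
      rw [← ball_prod_same]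
      exact ⟨hp, hγ⟩
    have h2 : e (p, γ) = j p := by
      rw [he]
      refine Prod.ext rfl ?_
      change γ - ι p.2 - p.1 • J (Nf γ) = 0
      rw [sub_sub, sub_eq_zero]
      exact h
    change γ = (e.symm (j p)).2
    rw [← h2, e.left_inv h1]

/-- A smooth vector field on a Banach space has a smooth local flow. -/
theorem exists_smooth_local_flow [CompleteSpace E] {f : E → E} (hf : ContDiff ℝ ∞ f) (x₀ : E) :
    ∃ θ : ℝ × E → E, (∀ᶠ p in 𝓝 ((0 : ℝ), x₀), ContDiffAt ℝ ∞ θ p) ∧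
      (∀ᶠ p in 𝓝 ((0 : ℝ), x₀), HasDerivAt (fun s ↦ θ (s, p.2)) (f (θ p)) p.1) ∧
      ∀ᶠ x in 𝓝 x₀, θ (0, x) = x := by
  let fc : C(E, E) := ⟨f, hf.continuous⟩
  obtain ⟨S, ε, hε, hSs, hSe, hSu⟩ := exists_smooth_solution fc hf x₀
  let I := Set.Icc (-1 : ℝ) 1
  let pr : ℝ → I := Set.projIcc (-1) 1 (by norm_num)
  have hpr : ∀ t (ht : t ∈ I), pr t = ⟨t, ht⟩ := fun t ht ↦ Set.projIcc_of_mem _ ht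
  let b : I := ⟨1, by norm_num, le_rfl⟩
  let ev : C(I, E) →L[ℝ] E := ContinuousMap.evalCLM ℝ b
  -- The parameter `s` rescales time, so the flow at time `s` is the endpoint at `t = 1` of the
  -- solution with parameter `s`.
  refine ⟨fun p ↦ S p b, ?_, ?_, ?_⟩
  · filter_upwards [hSs] with p hp
    exact ev.contDiff.contDiffAt.comp p hp
  · obtain ⟨δ, hδ, hδS⟩ := Metric.eventually_nhds_iff_ball.1
      (hSe.and (Metric.ball_mem_nhds _ hε))
    filter_upwards [Metric.ball_mem_nhds ((0 : ℝ), x₀) (half_pos hδ)] with p hp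
    rw [← ball_prod_same] at hp hδS
    obtain ⟨hp1, hp2⟩ := hp
    rw [mem_ball_zero_iff, Real.norm_eq_abs, abs_lt] at hp1
    set x := p.2
    set s₀ := δ / 2 with hs₀
    have hs₀pos : 0 < s₀ := half_pos hδ
    have hx : x ∈ Metric.ball x₀ δ := Metric.ball_subset_ball (by linarith) hp2
    have hmem : ∀ s, |s| ≤ s₀ → (s, x) ∈ Metric.ball (0 : ℝ) δ ×ˢ Metric.ball x₀ δ :=
      fun s hs ↦ ⟨by rw [mem_ball_zero_iff, Real.norm_eq_abs]; linarith, hx⟩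
    obtain ⟨⟨hγb, hγ⟩, -⟩ := hδS _ (hmem s₀ (abs_of_pos hs₀pos).le)
    set γ := S (s₀, x)
    have hγt : ∀ t : I, γ t = x + s₀ • ∫ τ in (0 : ℝ)..t, f (γ (pr τ)) := fun t ↦
      congrArg (fun c : C(I, E) ↦ c t) hγ
    -- The curve `t ↦ γ (r * t)` solves the equation with parameter `r * s₀`; by local uniqueness it
    -- is `S (r * s₀, x)`. All nearby flow times are thus read off the single curve `γ`.
    have hscale : ∀ r ∈ I, S (r * s₀, x) b = γ (pr r) := by
      intro r hr
      have hrt : ∀ t ∈ I, r * t ∈ I := fun t ht ↦ by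
        have : |r * t| ≤ 1 := by
          rw [abs_mul]
          exact mul_le_one₀ (abs_le.2 hr) (abs_nonneg _) (abs_le.2 ht)
        exact abs_le.1 this
      let γr : C(I, E) := ⟨fun t ↦ γ ⟨r * t, hrt t t.2⟩, by fun_prop⟩
      have h1 : γr = S (r * s₀, x) := by
        refine hSu (r * s₀, x) (hδS _ (hmem _ ?_)).2 γr ?_ ?_
        · rw [abs_mul, abs_of_pos hs₀pos]
          exact mul_le_of_le_one_left hs₀pos.le (abs_le.2 hr)
        · rw [Metric.mem_ball, ContinuousMap.dist_lt_iff hε] at hγb ⊢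
          exact fun t ↦ hγb _
        · ext t
          change γ _ = x + (r * s₀) • ∫ τ in (0 : ℝ)..t, f (γr (pr τ))
          rw [hγt, mul_comm r s₀, mul_smul]
          congr 2
          have h2 : ∀ τ ∈ Set.uIcc (0 : ℝ) t, f (γr (pr τ)) = f (γ (pr (r * τ))) := by
            intro τ hτ
            have hτI : τ ∈ I := Set.uIcc_subset_Icc (by norm_num [I]) t.2 hτ
            rw [hpr τ hτI, hpr _ (hrt _ hτI)]
            rfl
          rw [intervalIntegral.integral_congr h2,
            intervalIntegral.smul_integral_comp_mul_left (fun τ ↦ f (γ (pr τ))), mul_zero]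
      rw [← h1, hpr r hr]
      change γ _ = _
      simp [b]
    have hloc : (fun s ↦ S (s, x) b) =ᶠ[𝓝 p.1]
        fun s ↦ x + s₀ • ∫ τ in (0 : ℝ)..(s / s₀), f (γ (pr τ)) := by
      filter_upwards [Ioo_mem_nhds hp1.1 hp1.2] with s hs
      have hsI : s / s₀ ∈ I := by
        rw [Set.mem_Icc, le_div_iff₀ hs₀pos, div_le_iff₀ hs₀pos]
        exact ⟨by linarith [hs.1], by linarith [hs.2]⟩
      have := hscale _ hsI
      rw [div_mul_cancel₀ _ hs₀pos.ne'] at this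
      rw [this, hpr _ hsI, hγt]
    have hpI : p.1 / s₀ ∈ I := by
      rw [Set.mem_Icc, le_div_iff₀ hs₀pos, div_le_iff₀ hs₀pos]
      exact ⟨by linarith [hp1.1], by linarith [hp1.2]⟩
    have hval : S p b = γ (pr (p.1 / s₀)) := by
      have := hscale _ hpI
      rwa [div_mul_cancel₀ _ hs₀pos.ne'] at this
    rw [hloc.hasDerivAt_iff, hval]
    have hcont : Continuous fun τ ↦ f (γ (pr τ)) :=
      hf.continuous.comp (γ.continuous.comp continuous_projIcc)
    have h1 : HasDerivAt (fun u ↦ ∫ τ in (0 : ℝ)..u, f (γ (pr τ))) _ (p.1 / s₀) :=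
      intervalIntegral.integral_hasDerivAt_right (hcont.intervalIntegrable _ _)
        (hcont.stronglyMeasurableAtFilter _ _) hcont.continuousAt
    have h2 := ((h1.scomp p.1 ((hasDerivAt_id p.1).div_const s₀)).const_smul s₀).const_add x
    exact h2.congr_deriv (by rw [smul_smul, mul_one_div_cancel hs₀pos.ne', one_smul])
  · have hc : ContinuousAt (fun x : E ↦ ((0 : ℝ), x)) x₀ := by fun_prop
    filter_upwards [hc.eventually hSe] with x hx
    rw [hx.2]
    simp

/-- Straightening of a vector field: near a point where it does not vanish, a smooth vector field is
the image of a constant one under a local diffeomorphism. -/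
theorem exists_flow_box [FiniteDimensional ℝ E] {X : E → E} {p₀ : E}
    (hX : ∀ᶠ p in 𝓝 p₀, ContDiffAt ℝ ∞ X p) (hX0 : X p₀ ≠ 0) {v₀ : E} {l : E →L[ℝ] ℝ}
    (hl : l v₀ = 1) :
    ∃ Ψ : E → E, Ψ 0 = p₀ ∧ (∀ᶠ y in 𝓝 0, ContDiffAt ℝ ∞ Ψ y) ∧
      (∃ A : E ≃L[ℝ] E, HasFDerivAt Ψ (A : E →L[ℝ] E) 0) ∧
      ∀ᶠ y in 𝓝 0, fderiv ℝ Ψ y v₀ = X (Ψ y) := by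
  have : CompleteSpace E := FiniteDimensional.complete ℝ E
  obtain ⟨f, hf, hfX⟩ := exists_contDiff_eventuallyEq hX
  obtain ⟨θ, hθs, hθd, hθ0⟩ := exists_smooth_local_flow hf p₀
  have hv₀ : v₀ ≠ 0 := by
    rintro rfl
    simp at hl
  obtain ⟨A, hA⟩ := SeparatingDual.exists_continuousLinearEquiv_apply_eq (R := ℝ) hv₀ hX0
  -- The map is `Ψ y = θ (l y, p₀ + A (y - l y • v₀))`: `l` measures time and `A` places the
  -- transversal `ker l`. As `A v₀ = X p₀`, the derivative of `Ψ` at `0` is exactly `A`.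
  let B : E →L[ℝ] ℝ × E := l.prod ((A : E →L[ℝ] E) ∘L (ContinuousLinearMap.id ℝ E - l.smulRight v₀))
  let j : E → ℝ × E := fun y ↦ (0, p₀) + B y
  have hjd : ∀ y, HasFDerivAt j B y := fun y ↦ B.hasFDerivAt.const_add _
  have hj : ContDiff ℝ ∞ j := contDiff_const.add B.contDiff
  have hj0 : j 0 = (0, p₀) := by simp [j]
  have hjc : Filter.Tendsto j (𝓝 0) (𝓝 (0, p₀)) := by
    rw [← hj0]
    exact hj.continuous.continuousAt
  have hjs : ∀ y, ∀ s : ℝ, j (y + s • v₀) = ((j y).1 + s, (j y).2) := fun y s ↦ by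
    simp [j, B, hl, add_smul]
  have hΨ0 : θ (j 0) = p₀ := by rw [hj0, hθ0.self_of_nhds]
  have hΨs : ∀ᶠ y in 𝓝 0, ContDiffAt ℝ ∞ (fun y ↦ θ (j y)) y :=
    (hjc.eventually hθs).mono fun y hy ↦ hy.comp y hj.contDiffAt
  refine ⟨fun y ↦ θ (j y), hΨ0, hΨs, ⟨A, ?_⟩, ?_⟩
  · have h1 : HasFDerivAt θ (fderiv ℝ θ (0, p₀)) (0, p₀) :=
      (hθs.self_of_nhds.differentiableAt (by simp)).hasFDerivAt
    have h2 : fderiv ℝ θ (0, p₀) (1, 0) = X p₀ := by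
      have h3 : HasDerivAt (fun s : ℝ ↦ ((s, p₀) : ℝ × E)) (1, 0) 0 :=
        (hasDerivAt_id _).prodMk (hasDerivAt_const _ _)
      have h4 := hθd.self_of_nhds
      rw [hθ0.self_of_nhds, hfX.self_of_nhds] at h4
      exact (h1.comp_hasDerivAt (0 : ℝ) h3).unique h4
    have h5 : ∀ v, fderiv ℝ θ (0, p₀) (0, v) = v := by
      have h6 : HasFDerivAt (fun x : E ↦ ((0 : ℝ), x)) (ContinuousLinearMap.inr ℝ ℝ E) p₀ :=
        hasFDerivAt_prodMk_right _ _
      have h7 : HasFDerivAt (fun x : E ↦ θ (0, x)) (ContinuousLinearMap.id ℝ E) p₀ :=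
        (hasFDerivAt_id p₀).congr_of_eventuallyEq hθ0
      exact fun v ↦ congrArg (fun L : E →L[ℝ] E ↦ L v) ((h1.comp p₀ h6).unique h7)
    rw [← hj0] at h1
    refine (h1.comp 0 (hjd 0)).congr_fderiv ?_
    ext w
    have h8 : B w = l w • ((1 : ℝ), (0 : E)) + (0, A w - l w • X p₀) := by
      simp [B, hA]
    rw [ContinuousLinearMap.comp_apply, h8, hj0, map_add, map_smul, h2, h5]
    simp
  · have hΨc : Filter.Tendsto (fun y ↦ θ (j y)) (𝓝 0) (𝓝 p₀) := by
      have := hΨs.self_of_nhds.continuousAt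
      rwa [ContinuousAt, hΨ0] at this
    filter_upwards [hΨs, hjc.eventually hθd, hΨc.eventually hfX] with y hy hyd hyX
    have h1 := (hy.differentiableAt (by simp)).hasFDerivAt
    have h2 : HasDerivAt (fun s : ℝ ↦ y + s • v₀) v₀ 0 := by
      simpa using ((hasDerivAt_id (0 : ℝ)).smul_const v₀).const_add y
    have h3 : HasDerivAt (fun s : ℝ ↦ θ (j (y + s • v₀))) (f (θ (j y))) 0 := by
      simp only [hjs]
      have h4 : HasDerivAt (fun s ↦ θ (s, (j y).2)) (f (θ (j y))) ((j y).1 + 0) := by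
        rwa [add_zero]
      exact h4.comp_const_add (j y).1 0
    rw [← hyX]
    have h5 : HasFDerivAt (fun y ↦ θ (j y)) (fderiv ℝ (fun y ↦ θ (j y)) y)
      (y + (0 : ℝ) • v₀) := by simpa using h1
    have h6 := h5.comp_hasDerivAt (0 : ℝ) h2
    exact h6.unique h3

end Flow

/-! ### Primitives depending smoothly on parameters. -/

section ParametricPrimitive

/-- Smooth primitive, in the direction `v`, of a smooth function. -/
theorem exists_smooth_primitive {E : Type} [NormedAddCommGroup E] [NormedSpace ℝ E]
    {G : E → ℝ} (hG : ContDiff ℝ ∞ G) {l : E →L[ℝ] ℝ} {v : E} (hl : l v = 1)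
    {Q : E →L[ℝ] E} (hQ : Q v = 0) :
    ∃ h : E → ℝ, ContDiff ℝ ∞ h ∧ h 0 = 0 ∧ (∀ y, fderiv ℝ h y v = G (Q y + l y • v)) ∧
      ∀ y w, l w = 0 → Q w = 0 → fderiv ℝ h y w = 0 := by
  let I := Set.Icc (-1 : ℝ) 1
  let b : I := ⟨1, by norm_num, le_rfl⟩
  let Gc : C(E, ℝ) := ⟨G, hG.continuous⟩
  let ray : C(I, E) := ⟨fun t ↦ (t : ℝ) • v, by fun_prop⟩
  let c : E → C(I, E) := fun y ↦ ContinuousMap.constCLM I E (Q y) + l y • ray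
  have hc : ContDiff ℝ ∞ c := by fun_prop
  let J : C(I, ℝ) →L[ℝ] C(I, ℝ) := ContinuousMap.primitiveCLM ℝ
  let ev : C(I, ℝ) →L[ℝ] ℝ := ContinuousMap.evalCLM ℝ b
  -- This is `∫ G (Q y + τ • v)` over `0..l y`, rescaled to `0..1`: with fixed limits it is a
  -- composite of smooth operators, and no differentiation under the integral is needed.
  let h : E → ℝ := fun y ↦ l y * ev (J (Gc.comp (c y)))
  have hh : ContDiff ℝ ∞ h :=
    l.contDiff.mul ((ev ∘L J).contDiff.comp ((ContinuousMap.contDiff_postcomp Gc hG).comp hc))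
  have hint : ∀ y, h y = ∫ τ in (0 : ℝ)..l y, G (Q y + τ • v) := by
    intro y
    have h1 : ev (J (Gc.comp (c y))) = ∫ τ in (0 : ℝ)..1, G (Q y + (τ * l y) • v) := by
      change ∫ τ in (0 : ℝ)..1, _ = _
      refine intervalIntegral.integral_congr fun τ hτ ↦ ?_
      rw [Set.uIcc_of_le zero_le_one] at hτ
      change G (Q y + l y • ((Set.projIcc (-1 : ℝ) 1 (by norm_num) τ : I) : ℝ) • v) = _
      rw [Set.projIcc_of_mem _ (show τ ∈ Set.Icc (-1 : ℝ) 1 from ⟨by linarith [hτ.1], hτ.2⟩),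
        smul_smul, mul_comm]
    change l y * _ = _
    rw [h1]
    have h2 := intervalIntegral.smul_integral_comp_mul_right (a := 0) (b := 1)
      (fun τ ↦ G (Q y + τ • v)) (l y)
    rw [zero_mul, one_mul] at h2
    exact h2
  have hline : ∀ y w, HasDerivAt (fun s : ℝ ↦ h (y + s • w)) (fderiv ℝ h y w) 0 := by
    intro y w
    have h1 : HasFDerivAt h (fderiv ℝ h y) (y + (0 : ℝ) • w) := by
      simpa using (hh.differentiable (by simp) y).hasFDerivAt
    have h2 : HasDerivAt (fun s : ℝ ↦ y + s • w) w 0 := by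
      simpa using ((hasDerivAt_id (0 : ℝ)).smul_const w).const_add y
    exact h1.comp_hasDerivAt (0 : ℝ) h2
  refine ⟨h, hh, by simp [h], fun y ↦ ?_, fun y w hw hw' ↦ ?_⟩
  · refine (hline y v).unique ?_
    have h1 : (fun s : ℝ ↦ h (y + s • v)) = fun s ↦ ∫ τ in (0 : ℝ)..(l y + s), G (Q y + τ • v) := by
      ext s
      simp [hint, hl, hQ]
    rw [h1]
    have hcont : Continuous fun τ : ℝ ↦ G (Q y + τ • v) := hG.continuous.comp (by fun_prop)
    have h2 : HasDerivAt (fun u ↦ ∫ τ in (0 : ℝ)..u, G (Q y + τ • v)) (G (Q y + l y • v))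
        (l y + 0) := by
      rw [add_zero]
      exact intervalIntegral.integral_hasDerivAt_right (hcont.intervalIntegrable _ _)
        (hcont.stronglyMeasurableAtFilter _ _) hcont.continuousAt
    exact h2.comp_const_add (l y) 0
  · refine (hline y w).unique ?_
    have h1 : (fun s : ℝ ↦ h (y + s • w)) = fun _ ↦ h y := by
      ext s
      simp [hint, hw, hw']
    rw [h1]
    exact hasDerivAt_const _ _

end ParametricPrimitive

/-! ### Forms of codegree one as contractions of the volume form. -/

section AlternatingForms

/-- An alternating form on `ℝⁿ` is determined by its values on increasing families of vectors of
the standard basis. -/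
theorem ContinuousAlternatingMap.ext_orderEmbedding {n p : ℕ}
    {f g : EuclideanSpace ℝ (Fin n) [⋀^Fin p]→L[ℝ] ℝ}
    (h : ∀ I : Fin p ↪o Fin n, f (fun k ↦ EuclideanSpace.single (I k) 1) =
      g (fun k ↦ EuclideanSpace.single (I k) 1)) : f = g := by
  apply ContinuousAlternatingMap.toAlternatingMap_injective
  refine Module.Basis.ext_alternating (EuclideanSpace.basisFun (Fin n) ℝ).toBasis fun v hv ↦ ?_
  simp only [OrthonormalBasis.coe_toBasis, EuclideanSpace.basisFun_apply,
    ContinuousAlternatingMap.coe_toAlternatingMap]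
  let s : Finset (Fin n) := Finset.univ.image v
  have hs : s.card = p := by
    rw [Finset.card_image_of_injective _ hv, Finset.card_univ, Fintype.card_fin]
  let I := s.orderEmbOfFin hs
  have hvI : ∀ k, ∃ j, I j = v k := fun k ↦ by
    have : v k ∈ Set.range I := by
      rw [Finset.range_orderEmbOfFin]
      simp [s]
    exact this
  choose σ hσ using hvI
  have hσi : Function.Injective σ := fun a b hab ↦ hv (by rw [← hσ, ← hσ, hab])
  -- Sorting `v` into the increasing family `I` multiplies both forms by the same sign.
  let σ' : Equiv.Perm (Fin p) := Equiv.ofBijective σ (Finite.injective_iff_bijective.1 hσi)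
  have key : ∀ f : EuclideanSpace ℝ (Fin n) [⋀^Fin p]→L[ℝ] ℝ,
      f (fun k ↦ EuclideanSpace.single (v k) 1) =
        Equiv.Perm.sign σ' • f (fun k ↦ EuclideanSpace.single (I k) 1) := fun f ↦ by
    have := f.toAlternatingMap.map_perm (fun k ↦ EuclideanSpace.single (I k) (1 : ℝ)) σ'
    refine Eq.trans ?_ this
    simp [σ', Function.comp_def, hσ]
  rw [key, key, h]

/-- Such an embedding misses some index `i`; a count shows that it misses nothing else, and a
strictly monotone map is determined by its range. -/
theorem Fin.orderEmbedding_eq_succAboveOrderEmb {m : ℕ} (I : Fin m ↪o Fin (m + 1)) :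
    ∃ i : Fin (m + 1), I = i.succAboveOrderEmb := by
  have h : (Finset.univ.image I).card < (Finset.univ : Finset (Fin (m + 1))).card := by
    rw [Finset.card_image_of_injective _ I.injective]
    simp
  obtain ⟨i, -, hi⟩ := Finset.exists_mem_notMem_of_card_lt_card h
  have hI : ∀ k, I k ≠ i := fun k hk ↦ hi (Finset.mem_image.2 ⟨k, Finset.mem_univ _, hk⟩)
  refine ⟨i, ?_⟩
  refine DFunLike.ext' (StrictMono.range_inj I.strictMono i.succAboveOrderEmb.strictMono |>.1 ?_)
  have hsub : Set.range I ⊆ Set.range i.succAboveOrderEmb := by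
    rintro _ ⟨k, rfl⟩
    exact Fin.exists_succAbove_eq (hI k)
  refine Set.eq_of_subset_of_ncard_le hsub ?_ (Set.toFinite _)
  rw [← Set.image_univ, ← Set.image_univ, Set.ncard_image_of_injective _ I.injective,
    Set.ncard_image_of_injective _ i.succAboveOrderEmb.injective]

/-- The standard volume form of `ℝⁿ`. -/
noncomputable def EuclideanSpace.volForm (n : ℕ) :
    EuclideanSpace ℝ (Fin n) [⋀^Fin n]→L[ℝ] ℝ :=
  { (EuclideanSpace.basisFun (Fin n) ℝ).toBasis.det with
    cont := by
      change Continuous fun v : Fin n → EuclideanSpace ℝ (Fin n) ↦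
        ((EuclideanSpace.basisFun (Fin n) ℝ).toBasis.toMatrix v).det
      refine Continuous.matrix_det (continuous_matrix fun i j ↦ ?_)
      simp only [Module.Basis.toMatrix_apply, OrthonormalBasis.coe_toBasis_repr_apply,
        EuclideanSpace.basisFun_repr]
      fun_prop }

namespace EuclideanSpace

theorem volForm_single (n : ℕ) : volForm n (fun i ↦ EuclideanSpace.single i 1) = 1 := by
  have := (EuclideanSpace.basisFun (Fin n) ℝ).toBasis.det_self
  rwa [OrthonormalBasis.coe_toBasis,
    show ⇑(EuclideanSpace.basisFun (Fin n) ℝ) = fun i ↦ EuclideanSpace.single i 1 from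
      funext fun i ↦ EuclideanSpace.basisFun_apply _ _ i] at this

theorem volForm_comp {n : ℕ} (A : EuclideanSpace ℝ (Fin n) →ₗ[ℝ] EuclideanSpace ℝ (Fin n))
    (v : Fin n → EuclideanSpace ℝ (Fin n)) :
    volForm n (fun i ↦ A (v i)) = LinearMap.det A * volForm n v :=
  (EuclideanSpace.basisFun (Fin n) ℝ).toBasis.det_comp A v

/-- The form `du¹ ∧ ⋯ ∧ duᵐ` on `ℝᵐ⁺¹` with coordinates `u⁰, …, uᵐ`. -/
noncomputable def transverseForm (m : ℕ) : EuclideanSpace ℝ (Fin (m + 1)) [⋀^Fin m]→L[ℝ] ℝ :=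
  (volForm (m + 1)).curryLeft (EuclideanSpace.single 0 1)

theorem transverseForm_apply {m : ℕ} (v : Fin m → EuclideanSpace ℝ (Fin (m + 1))) :
    transverseForm m v = volForm (m + 1) (Matrix.vecCons (EuclideanSpace.single 0 1) v) := rfl

/-- Contracting with `A e₀` and then pulling back by `A` is contracting `A^* vol = det A • vol` with
`e₀`. Both coordinate changes below are computed this way. -/
theorem transverseForm_comp {m : ℕ}
    (A : EuclideanSpace ℝ (Fin (m + 1)) →L[ℝ] EuclideanSpace ℝ (Fin (m + 1))) :
    ((volForm (m + 1)).curryLeft (A (EuclideanSpace.single 0 1))).compContinuousLinearMap A =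
      LinearMap.det (A : EuclideanSpace ℝ (Fin (m + 1)) →ₗ[ℝ] EuclideanSpace ℝ (Fin (m + 1))) •
        transverseForm m := by
  ext v
  refine Eq.trans ?_ (volForm_comp _ (Matrix.vecCons (EuclideanSpace.single 0 1) v))
  change volForm (m + 1) _ = _
  congr 1
  ext i
  refine Fin.cases ?_ (fun i ↦ ?_) i <;> rfl

/-- The vector field whose contraction with the volume form is a given form of codegree one. -/
noncomputable def dualVector {m : ℕ} (η : EuclideanSpace ℝ (Fin (m + 1)) [⋀^Fin m]→L[ℝ] ℝ) :
    EuclideanSpace ℝ (Fin (m + 1)) :=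
  ∑ i : Fin (m + 1), ((-1) ^ (i : ℕ) * η (fun k ↦ EuclideanSpace.single (i.succAbove k) 1)) •
    EuclideanSpace.single i (1 : ℝ)

/-- On the basis vectors other than `e_i`, only the `i`-th summand survives, the others repeating a
vector; the sign `(-1) ^ i` undoes moving `e_i` from the first slot to its own. -/
theorem volForm_curryLeft_dualVector {m : ℕ}
    (η : EuclideanSpace ℝ (Fin (m + 1)) [⋀^Fin m]→L[ℝ] ℝ) :
    (volForm (m + 1)).curryLeft (dualVector η) = η := by
  refine ContinuousAlternatingMap.ext_orderEmbedding fun I ↦ ?_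
  obtain ⟨i, rfl⟩ := Fin.orderEmbedding_eq_succAboveOrderEmb I
  set w : Fin m → EuclideanSpace ℝ (Fin (m + 1)) :=
    fun k ↦ EuclideanSpace.single (i.succAboveOrderEmb k) 1 with hw
  have h1 : ∀ j, j ≠ i → (volForm (m + 1)).curryLeft (EuclideanSpace.single j 1) w = 0 := by
    intro j hj
    obtain ⟨k, rfl⟩ := Fin.exists_succAbove_eq hj
    refine (volForm (m + 1)).map_eq_zero_of_eq _ (i := 0) (j := k.succ) ?_
      (Fin.succ_ne_zero k).symm
    rfl
  have h2 : (-1) ^ (i : ℕ) * (volForm (m + 1)).curryLeft (EuclideanSpace.single i 1) w = 1 := by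
    have h3 := (volForm (m + 1)).map_insertNth i (EuclideanSpace.single i 1) w
    rw [show i.insertNth (EuclideanSpace.single i 1) w = fun j ↦ EuclideanSpace.single j (1 : ℝ) from
      Fin.insertNth_eq_iff.2 ⟨rfl, rfl⟩, volForm_single] at h3
    simpa using h3.symm
  rw [dualVector, map_sum, ContinuousAlternatingMap.sum_apply,
    Finset.sum_eq_single i (fun j _ hj ↦ ?_) (by simp)]
  · rw [map_smul, ContinuousAlternatingMap.smul_apply, smul_eq_mul, mul_right_comm, h2, one_mul]
    rfl
  · rw [map_smul, ContinuousAlternatingMap.smul_apply, h1 j hj, smul_zero]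

end EuclideanSpace

end AlternatingForms

/-! ### Flat coordinates for closed forms on Euclidean space. -/

section LocalNormalForm

theorem ContinuousLinearMap.exists_equiv_of_det_ne_zero {E : Type*} [NormedAddCommGroup E]
    [NormedSpace ℝ E] [FiniteDimensional ℝ E] (A : E →L[ℝ] E)
    (hA : LinearMap.det (A : E →ₗ[ℝ] E) ≠ 0) : ∃ B : E ≃L[ℝ] E, (B : E →L[ℝ] E) = A :=
  ⟨((A : E →ₗ[ℝ] E).equivOfDetNeZero hA).toContinuousLinearEquiv, by ext; rfl⟩

theorem ContinuousLinearEquiv.det_coe_ne_zero {E : Type*} [NormedAddCommGroup E]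
    [NormedSpace ℝ E] (A : E ≃L[ℝ] E) : LinearMap.det ((A : E →L[ℝ] E) : E →ₗ[ℝ] E) ≠ 0 :=
  (LinearEquiv.isUnit_det' A.toLinearEquiv).ne_zero

namespace EuclideanSpace

theorem transverseForm_single_succ (m : ℕ) :
    transverseForm m (fun k ↦ EuclideanSpace.single k.succ 1) = 1 := by
  rw [transverseForm_apply]
  refine Eq.trans ?_ (volForm_single (m + 1))
  congr 1
  ext i
  refine Fin.cases ?_ (fun i ↦ ?_) i <;> rfl

/-- Omitting `e₀` leaves `∂g/∂u⁰`; omitting any other vector leaves `e₀` among the arguments, which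
kills `transverseForm`. Closedness thus becomes `∂g/∂u⁰ = 0`. -/
theorem extDeriv_smul_transverseForm {m : ℕ} {g : EuclideanSpace ℝ (Fin (m + 1)) → ℝ}
    {y : EuclideanSpace ℝ (Fin (m + 1))} (hg : DifferentiableAt ℝ g y) :
    extDeriv (fun y ↦ g y • transverseForm m) y (fun i ↦ EuclideanSpace.single i 1) =
      fderiv ℝ g y (EuclideanSpace.single 0 1) := by
  rw [extDeriv_apply (hg.smul_const _), Fin.sum_univ_succ, Finset.sum_eq_zero, add_zero]
  · have h : ∀ y, (g y • transverseForm m)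
        (Fin.removeNth 0 fun i ↦ EuclideanSpace.single i (1 : ℝ)) = g y := fun y ↦ by
      have := transverseForm_single_succ m
      rw [ContinuousAlternatingMap.smul_apply, smul_eq_mul]
      exact (congrArg (g y * ·) this).trans (mul_one _)
    simp only [h]
    simp
  · intro i _
    have h : ∀ y, (g y • transverseForm m)
        (Fin.removeNth i.succ fun i ↦ EuclideanSpace.single i (1 : ℝ)) = 0 := fun y ↦ by
      rw [ContinuousAlternatingMap.smul_apply, transverseForm_apply,
        (volForm (m + 1)).map_eq_zero_of_eq _ (i := 0)
          (j := (⟨0, Fin.pos i⟩ : Fin m).succ) ?_ (Fin.succ_ne_zero _).symm, smul_zero]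
      simp only [Matrix.cons_val_zero, Matrix.cons_val_succ, Fin.removeNth]
      congr 1
    simp only [h]
    simp

/-- A change of the coordinates transverse to `∂/∂u⁰` which normalizes the density of a form of
codegree one. -/
theorem exists_contDiff_transverseForm_comp_eq {k : ℕ}
    {G : EuclideanSpace ℝ (Fin (k + 2)) → ℝ} (hG : ContDiff ℝ ∞ G) (hG0 : G 0 ≠ 0) :
    ∃ F : EuclideanSpace ℝ (Fin (k + 2)) → EuclideanSpace ℝ (Fin (k + 2)), F 0 = 0 ∧
      ContDiff ℝ ∞ F ∧ (∃ A : EuclideanSpace ℝ (Fin (k + 2)) ≃L[ℝ] EuclideanSpace ℝ (Fin (k + 2)),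
        HasFDerivAt F (A : EuclideanSpace ℝ (Fin (k + 2)) →L[ℝ] EuclideanSpace ℝ (Fin (k + 2))) 0) ∧
      ∀ y, (transverseForm (k + 1)).compContinuousLinearMap (fderiv ℝ F y) =
        G (y - y 0 • EuclideanSpace.single 0 1) • transverseForm (k + 1) := by
  let V := EuclideanSpace ℝ (Fin (k + 2))
  let e₀ : V := EuclideanSpace.single 0 1
  let e₁ : V := EuclideanSpace.single 1 1
  let l₀ : V →L[ℝ] ℝ := EuclideanSpace.proj 0
  let l₁ : V →L[ℝ] ℝ := EuclideanSpace.proj 1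
  have hsingle : ∀ i j : Fin (k + 2), (EuclideanSpace.proj i : V →L[ℝ] ℝ)
      (EuclideanSpace.single j (1 : ℝ)) = if i = j then 1 else 0 := fun i j ↦ by
    change (EuclideanSpace.single j (1 : ℝ) : EuclideanSpace ℝ (Fin (k + 2))).ofLp i = _
    simp
  have h00 : l₀ e₀ = 1 := hsingle 0 0
  have h01 : l₀ e₁ = 0 := hsingle 0 1
  have h10 : l₁ e₀ = 0 := hsingle 1 0
  have h11 : l₁ e₁ = 1 := hsingle 1 1
  let Q : V →L[ℝ] V := ContinuousLinearMap.id ℝ V - l₀.smulRight e₀ - l₁.smulRight e₁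
  have hQ : ∀ y, Q y = y - l₀ y • e₀ - l₁ y • e₁ := fun _ ↦ rfl
  obtain ⟨h, hh, hh0, hh1, hhw⟩ := exists_smooth_primitive hG (l := l₁) (v := e₁) (Q := Q) h11
    (by simp [hQ, h01, h11])
  have hhe₀ : ∀ y, fderiv ℝ h y e₀ = 0 := fun y ↦ hhw y e₀ h10 (by simp [hQ, h00, h10])
  -- `F` replaces the coordinate `u¹` by `h`. Its derivative is a transvection with determinant
  -- `∂h/∂u¹`, and it fixes `e₀` because `h` does not depend on `u⁰`.
  let F : V → V := fun y ↦ y + (h y - l₁ y) • e₁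
  have hF : ContDiff ℝ ∞ F := contDiff_id.add ((hh.sub l₁.contDiff).smul contDiff_const)
  let f : V → V →L[ℝ] ℝ := fun y ↦ fderiv ℝ h y - l₁
  have hF' : ∀ y, HasFDerivAt F (ContinuousLinearMap.id ℝ V + (f y).smulRight e₁) y := fun y ↦
    (hasFDerivAt_id y).add
      ((((hh.differentiable (by simp) y).hasFDerivAt).sub l₁.hasFDerivAt).smul_const e₁)
  have hdet : ∀ y, LinearMap.det ((fderiv ℝ F y : V →L[ℝ] V) : V →ₗ[ℝ] V) = G (y - y 0 • e₀) := by
    intro y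
    have h1 : ((fderiv ℝ F y : V →L[ℝ] V) : V →ₗ[ℝ] V) =
        LinearMap.transvection (f y : V →ₗ[ℝ] ℝ) e₁ := by
      rw [(hF' y).fderiv]
      ext v : 1
      rfl
    rw [h1, LinearMap.transvection.det]
    change 1 + (fderiv ℝ h y e₁ - l₁ e₁) = _
    rw [hh1, h11, add_sub_cancel]
    rw [hQ, sub_add_cancel]
    rfl
  refine ⟨F, by simp [F, hh0], hF, ?_, fun y ↦ ?_⟩
  · obtain ⟨A, hA⟩ := (fderiv ℝ F 0).exists_equiv_of_det_ne_zero (by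
      rw [hdet]
      simpa using hG0)
    exact ⟨A, by rw [hA]; exact (hF.differentiable (by simp) 0).hasFDerivAt⟩
  · have h1 : fderiv ℝ F y e₀ = e₀ := by
      rw [(hF' y).fderiv]
      simp [f, hhe₀, h10]
    have h2 := transverseForm_comp (fderiv ℝ F y)
    rw [hdet] at h2
    rw [← h2]
    change _ = ((volForm (k + 1 + 1)).curryLeft (fderiv ℝ F y e₀)).compContinuousLinearMap _
    rw [h1]
    rfl

theorem contDiffAt_dualVector {m : ℕ}
    {η : EuclideanSpace ℝ (Fin (m + 1)) → EuclideanSpace ℝ (Fin (m + 1)) [⋀^Fin m]→L[ℝ] ℝ}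
    {p : EuclideanSpace ℝ (Fin (m + 1))} (hη : ContDiffAt ℝ ∞ η p) :
    ContDiffAt ℝ ∞ (fun p ↦ dualVector (η p)) p := by
  unfold dualVector
  refine ContDiffAt.sum fun i _ ↦ ?_
  have h : ContDiffAt ℝ ∞ (fun p ↦ η p fun k ↦ EuclideanSpace.single (i.succAbove k) 1) p :=
    (ContinuousAlternatingMap.apply ℝ _ ℝ fun k ↦
      EuclideanSpace.single (i.succAbove k) (1 : ℝ)).contDiff.contDiffAt.comp p hη
  exact (contDiffAt_const.mul h).smul contDiffAt_const

/-- A closed form of codegree one is, near a point where it does not vanish and in suitable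
coordinates, a multiple of `du¹ ∧ ⋯ ∧ duᵐ` which does not depend on `u⁰`. -/
theorem exists_comp_eq_smul_transverseForm {m : ℕ}
    {η : EuclideanSpace ℝ (Fin (m + 1)) → EuclideanSpace ℝ (Fin (m + 1)) [⋀^Fin m]→L[ℝ] ℝ}
    {p₀ : EuclideanSpace ℝ (Fin (m + 1))} (hη : ∀ᶠ p in 𝓝 p₀, ContDiffAt ℝ ∞ η p)
    (hd : ∀ᶠ p in 𝓝 p₀, extDeriv η p = 0) (h0 : η p₀ ≠ 0) :
    ∃ (Ψ : EuclideanSpace ℝ (Fin (m + 1)) → EuclideanSpace ℝ (Fin (m + 1)))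
      (G : EuclideanSpace ℝ (Fin (m + 1)) → ℝ), Ψ 0 = p₀ ∧ (∀ᶠ y in 𝓝 0, ContDiffAt ℝ ∞ Ψ y) ∧
      (∃ A : EuclideanSpace ℝ (Fin (m + 1)) ≃L[ℝ] EuclideanSpace ℝ (Fin (m + 1)),
        HasFDerivAt Ψ (A : EuclideanSpace ℝ (Fin (m + 1)) →L[ℝ] EuclideanSpace ℝ (Fin (m + 1))) 0) ∧
      ContDiff ℝ ∞ G ∧ G 0 ≠ 0 ∧ ∀ᶠ y in 𝓝 0, (η (Ψ y)).compContinuousLinearMap (fderiv ℝ Ψ y) =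
        G (y - y 0 • EuclideanSpace.single 0 1) • transverseForm m := by
  let V := EuclideanSpace ℝ (Fin (m + 1))
  let e₀ : V := EuclideanSpace.single 0 1
  let l₀ : V →L[ℝ] ℝ := EuclideanSpace.proj 0
  have hX0 : dualVector (η p₀) ≠ 0 := fun h ↦ h0 (by
    rw [← volForm_curryLeft_dualVector (η p₀), h, map_zero])
  obtain ⟨Ψ, hΨ0, hΨ, ⟨A, hA⟩, hΨX⟩ := exists_flow_box (hη.mono fun p hp ↦ contDiffAt_dualVector hp)
    hX0 (v₀ := e₀) (l := l₀) (by simp [l₀, e₀])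
  have hΨc : Filter.Tendsto Ψ (𝓝 0) (𝓝 p₀) := by
    have := hΨ.self_of_nhds.continuousAt
    rwa [ContinuousAt, hΨ0] at this
  let g : V → ℝ := fun y ↦ volForm (m + 1) fun i ↦ fderiv ℝ Ψ y (EuclideanSpace.single i 1)
  have hgdet : ∀ y, g y = LinearMap.det ((fderiv ℝ Ψ y : V →L[ℝ] V) : V →ₗ[ℝ] V) := fun y ↦ by
    have := volForm_comp ((fderiv ℝ Ψ y : V →L[ℝ] V) : V →ₗ[ℝ] V)
      fun i ↦ EuclideanSpace.single i 1
    rwa [volForm_single, mul_one] at this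
  have hg : ∀ᶠ y in 𝓝 0, ContDiffAt ℝ ∞ g y := hΨ.mono fun y hy ↦ by
    have h1 : ContDiffAt ℝ ∞ (fun y ↦ fun i ↦ fderiv ℝ Ψ y (EuclideanSpace.single i 1)) y :=
      contDiffAt_pi.2 fun i ↦ (hy.fderiv_right (by simp)).clm_apply contDiffAt_const
    exact (volForm (m + 1)).toContinuousMultilinearMap.contDiff.contDiffAt.comp y h1
  have hpull : ∀ᶠ y in 𝓝 0, (η (Ψ y)).compContinuousLinearMap (fderiv ℝ Ψ y) =
      g y • transverseForm m := hΨX.mono fun y hy ↦ by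
    rw [hgdet, ← transverseForm_comp]
    congr 1
    rw [← volForm_curryLeft_dualVector (η (Ψ y)), ← hy]
  have hg0 : ∀ᶠ y in 𝓝 0, fderiv ℝ g y e₀ = 0 := by
    filter_upwards [hpull.eventually_nhds, hg, hΨ, hΨc.eventually hη, hΨc.eventually hd]
      with y hy hgy (hΨy : ContDiffAt ℝ ∞ Ψ y) (hηy : ContDiffAt ℝ ∞ η (Ψ y))
      (hdy : extDeriv η (Ψ y) = 0)
    rw [← extDeriv_smul_transverseForm (hgy.differentiableAt (by simp)),
      ← Filter.EventuallyEq.extDeriv_eq hy,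
      extDeriv_pullback (hηy.differentiableAt (by simp)) hΨy
        (by simpa using WithTop.coe_le_coe.2 (le_top : (2 : ℕ∞) ≤ ⊤)), hdy]
    rfl
  obtain ⟨G, hG, hGg⟩ := exists_contDiff_eventuallyEq hg
  refine ⟨Ψ, G, hΨ0, hΨ, ⟨A, hA⟩, hG, ?_, ?_⟩
  · rw [hGg.self_of_nhds, hgdet, hA.fderiv]
    exact A.det_coe_ne_zero
  obtain ⟨r, hr, hrb⟩ := Metric.eventually_nhds_iff_ball.1 (hg0.and (hg.and hGg))
  let π : V → V := fun y ↦ y - y 0 • e₀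
  have hπ : Continuous π := continuous_id.sub (l₀.continuous.smul continuous_const)
  have hπ0 : ∀ᶠ y in 𝓝 0, π y ∈ Metric.ball (0 : V) r :=
    hπ.continuousAt.eventually_mem (by
      simpa [π] using Metric.ball_mem_nhds (0 : V) hr)
  filter_upwards [hpull, hπ0, Metric.ball_mem_nhds 0 hr] with y hy hπy hyr
  rw [hy]
  congr 1
  change g y = G (π y)
  rw [show G (π y) = g (π y) from (hrb _ hπy).2.2]
  -- The segment from `π y` to `y` is parallel to `e₀` and stays in the ball by convexity, so `g` is
  -- constant along it.
  have hseg : ∀ s ∈ Set.Icc (0 : ℝ) 1, π y + s • (y 0 • e₀) ∈ Metric.ball (0 : V) r := by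
    intro s hs
    have := (convex_ball (0 : V) r).add_smul_sub_mem hπy hyr hs
    simpa [π] using this
  have hder : ∀ s ∈ Set.Icc (0 : ℝ) 1,
      HasDerivAt (fun s : ℝ ↦ g (π y + s • (y 0 • e₀))) 0 s := by
    intro s hs
    obtain ⟨h1, h2, -⟩ := hrb _ (hseg s hs)
    have h3 : HasDerivAt (fun s : ℝ ↦ π y + s • (y 0 • e₀)) (y 0 • e₀) s := by
      exact (((hasDerivAt_id s).smul_const (y 0 • e₀)).const_add (π y)).congr_deriv (one_smul ℝ _)
    have h4 := (h2.differentiableAt (by simp)).hasFDerivAt.comp_hasDerivAt s h3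
    rwa [map_smul, h1, smul_zero] at h4
  have := constant_of_has_deriv_right_zero
    (fun s hs ↦ (hder s hs).continuousAt.continuousWithinAt)
    (fun s hs ↦ (hder s ⟨hs.1, hs.2.le⟩).hasDerivWithinAt) 1 ⟨zero_le_one, le_rfl⟩
  simpa [π] using this

/-- The flat-coordinates theorem for closed forms of codegree one on Euclidean space: near a point
where it does not vanish, such a form is the pull-back of a constant form under a local
diffeomorphism. -/
theorem exists_pullback_const_eq {m : ℕ}
    {η : EuclideanSpace ℝ (Fin (m + 1)) → EuclideanSpace ℝ (Fin (m + 1)) [⋀^Fin m]→L[ℝ] ℝ}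
    {p₀ : EuclideanSpace ℝ (Fin (m + 1))} (hη : ∀ᶠ p in 𝓝 p₀, ContDiffAt ℝ ∞ η p)
    (hd : ∀ᶠ p in 𝓝 p₀, extDeriv η p = 0) (h0 : η p₀ ≠ 0) :
    ∃ (f : EuclideanSpace ℝ (Fin (m + 1)) → EuclideanSpace ℝ (Fin (m + 1)))
      (c : EuclideanSpace ℝ (Fin (m + 1)) [⋀^Fin m]→L[ℝ] ℝ), f p₀ = 0 ∧
      (∀ᶠ p in 𝓝 p₀, ContDiffAt ℝ ∞ f p) ∧
      (∃ A : EuclideanSpace ℝ (Fin (m + 1)) ≃L[ℝ] EuclideanSpace ℝ (Fin (m + 1)), HasFDerivAt f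
        (A : EuclideanSpace ℝ (Fin (m + 1)) →L[ℝ] EuclideanSpace ℝ (Fin (m + 1))) p₀) ∧
      ∀ᶠ p in 𝓝 p₀, c.compContinuousLinearMap (fderiv ℝ f p) = η p := by
  cases m with
  | zero =>
    refine ⟨fun p ↦ p - p₀, η p₀, sub_self _,
      Filter.Eventually.of_forall fun p ↦ (contDiff_id.sub contDiff_const).contDiffAt,
      ⟨ContinuousLinearEquiv.refl ℝ _, (hasFDerivAt_id p₀).sub_const p₀⟩, ?_⟩
    obtain ⟨r, hr, hrb⟩ := Metric.eventually_nhds_iff_ball.1 (hη.and hd)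
    let L := ContinuousAlternatingMap.apply ℝ (EuclideanSpace ℝ (Fin 1)) ℝ ![]
    have hdiff : ∀ p ∈ Metric.ball p₀ r, HasFDerivAt (fun p ↦ L (η p))
        (0 : EuclideanSpace ℝ (Fin 1) →L[ℝ] ℝ) p := by
      intro p hp
      have h1 := (hrb p hp).1.differentiableAt (by simp)
      refine (L.hasFDerivAt.comp p h1.hasFDerivAt).congr_fderiv ?_
      ext v
      have h2 := congrArg (fun β : EuclideanSpace ℝ (Fin 1) [⋀^Fin 1]→L[ℝ] ℝ ↦ β fun _ : Fin 1 ↦ v) (hrb p hp).2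
      simp only [extDeriv_apply h1] at h2
      have h3 : HasFDerivAt (fun p ↦ L (η p)) _ p := L.hasFDerivAt.comp p h1.hasFDerivAt
      rw [← h3.fderiv]
      simpa [L, Subsingleton.elim _ (![] : Fin 0 → EuclideanSpace ℝ (Fin 1))] using h2
    filter_upwards [Metric.ball_mem_nhds p₀ hr] with p hp
    have h4 := (convex_ball p₀ r).norm_image_sub_le_of_norm_hasFDerivWithin_le (C := 0)
      (fun p hp ↦ (hdiff p hp).hasFDerivWithinAt) (by simp) (Metric.mem_ball_self hr) hp
    rw [zero_mul, norm_le_zero_iff, sub_eq_zero] at h4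
    ext v
    rw [Subsingleton.elim v ![]]
    refine Eq.trans ?_ h4.symm
    exact congrArg (η p₀) (Subsingleton.elim _ _)
  | succ k =>
    let V := EuclideanSpace ℝ (Fin (k + 2))
    obtain ⟨Ψ, G, hΨ0, hΨ, ⟨A, hA⟩, hG, hG0, hpull⟩ := exists_comp_eq_smul_transverseForm hη hd h0
    obtain ⟨F, hF0, hF, ⟨B, hB⟩, hFG⟩ := exists_contDiff_transverseForm_comp_eq hG hG0
    obtain ⟨e, he, h0e, heU, hes⟩ := exists_openPartialHomeomorph_of_contDiffAt
      (hpull.and hΨ) (fun y hy ↦ hy.2) A hA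
    have hp₀ : p₀ ∈ e.target := by
      rw [← hΨ0, ← he]
      exact e.map_source h0e
    have hp₀' : e.symm p₀ = 0 := by
      rw [← hΨ0, ← he, e.left_inv h0e]
    have htarget := e.open_target.mem_nhds hp₀
    -- With `f = F ∘ Ψ⁻¹`, pulling `transverseForm` back by `F` gives `Ψ^* η`, and pulling that back
    -- by `Ψ⁻¹` recovers `η`.
    refine ⟨fun p ↦ F (e.symm p), transverseForm (k + 1), by simp only [hp₀', hF0], ?_, ?_, ?_⟩
    · filter_upwards [htarget] with p hp
      exact hF.contDiffAt.comp p (hes p hp)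
    · have h1 : HasFDerivAt e.symm (A.symm : V →L[ℝ] V) p₀ :=
        e.hasFDerivAt_symm hp₀ (by rw [hp₀', he]; exact hA)
      rw [← hp₀'] at hB
      exact ⟨A.symm.trans B, by simpa using! hB.comp p₀ h1⟩
    · filter_upwards [htarget] with p hp
      obtain ⟨hy, hΨy⟩ := heU (e.map_target hp)
      have h1 : HasFDerivAt e.symm _ p := ((hes p hp).differentiableAt (by simp)).hasFDerivAt
      have h2 : HasFDerivAt (fun p ↦ F (e.symm p)) _ p :=
        ((hF.differentiable (by simp) (e.symm p)).hasFDerivAt).comp p h1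
      have h3 : HasFDerivAt (fun p ↦ Ψ (e.symm p)) _ p :=
        ((hΨy.differentiableAt (by simp)).hasFDerivAt).comp p h1
      have h4 : HasFDerivAt (fun p ↦ Ψ (e.symm p)) (ContinuousLinearMap.id ℝ V) p := by
        refine (hasFDerivAt_id p).congr_of_eventuallyEq ?_
        filter_upwards [e.open_target.mem_nhds hp] with q hq
        rw [← he]
        exact e.right_inv hq
      have h5 := h3.unique h4
      have h6 : Ψ (e.symm p) = p := by
        rw [← he]
        exact e.right_inv hp
      rw [h2.fderiv]
      change ((transverseForm (k + 1)).compContinuousLinearMap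
        (fderiv ℝ F (e.symm p))).compContinuousLinearMap (fderiv ℝ e.symm p) = _
      rw [hFG, ← hy]
      change (η (Ψ (e.symm p))).compContinuousLinearMap
        ((fderiv ℝ Ψ (e.symm p)).comp (fderiv ℝ e.symm p)) = _
      rw [h5, h6]
      rfl

end EuclideanSpace

end LocalNormalForm

/-! ### Change of charts and transfer to the manifold. -/

namespace DiffForm

section Charts

variable {n : ℕ} {M : Type*} [TopologicalSpace M]
  {φ ψ : OpenPartialHomeomorph M (EuclideanSpace ℝ (Fin n))}

theorem eventually_mem_transition {u : EuclideanSpace ℝ (Fin n)}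
    (hu : u ∈ ψ.target) (hu' : ψ.symm u ∈ φ.source) :
    ∀ᶠ w in 𝓝 u, w ∈ ψ.target ∧ ψ.symm w ∈ φ.source :=
  (ψ.open_target.eventually_mem hu).and
    ((ψ.continuousAt_symm hu).eventually_mem (φ.open_source.mem_nhds hu'))

variable [ChartedSpace (EuclideanSpace ℝ (Fin n)) M]

theorem mdifferentiable_of_mem_maximalAtlas (hφ : φ ∈ IsManifold.maximalAtlas (𝓡 n) ∞ M) :
    φ.MDifferentiable (𝓡 n) (𝓡 n) :=
  ⟨fun _ hy ↦ ((contMDiffAt_of_mem_maximalAtlas hφ hy).mdifferentiableAt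
      (by simp)).mdifferentiableWithinAt,
    fun _ hu ↦ ((contMDiffAt_symm_of_mem_maximalAtlas hφ hu).mdifferentiableAt
      (by simp)).mdifferentiableWithinAt⟩

theorem contDiffAt_transition (hφ : φ ∈ IsManifold.maximalAtlas (𝓡 n) ∞ M)
    (hψ : ψ ∈ IsManifold.maximalAtlas (𝓡 n) ∞ M) {u : EuclideanSpace ℝ (Fin n)}
    (hu : u ∈ ψ.target) (hu' : ψ.symm u ∈ φ.source) :
    ContDiffAt ℝ ∞ (fun u ↦ φ (ψ.symm u)) u :=
  ContMDiffAt.contDiffAt ((contMDiffAt_of_mem_maximalAtlas hφ hu').comp u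
    (contMDiffAt_symm_of_mem_maximalAtlas hψ hu))

/-- The local expressions of a form in two charts are related by the transition map. -/
theorem inChart_eq_comp {p : ℕ} (α : Form n M p) (hφ : φ ∈ IsManifold.maximalAtlas (𝓡 n) ∞ M)
    (hψ : ψ ∈ IsManifold.maximalAtlas (𝓡 n) ∞ M) {u : EuclideanSpace ℝ (Fin n)}
    (hu : u ∈ ψ.target) (hu' : ψ.symm u ∈ φ.source) :
    inChart α ψ u = (inChart α φ (φ (ψ.symm u))).compContinuousLinearMap
      (fderiv ℝ (fun u ↦ φ (ψ.symm u)) u) := by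
  let V := EuclideanSpace ℝ (Fin n)
  -- Every tangent space is definitionally `V`; forgetting the dependence on the point lets base
  -- points be rewritten.
  let a : M → V [⋀^Fin p]→L[ℝ] ℝ := α
  let τ : V → V := fun u ↦ φ (ψ.symm u)
  have hτ : MDifferentiableAt (𝓡 n) (𝓡 n) τ u :=
    ((contDiffAt_transition hφ hψ hu hu').differentiableAt (by simp)).mdifferentiableAt
  have hφs : MDifferentiableAt (𝓡 n) (𝓡 n) φ.symm (τ u) :=
    (contMDiffAt_symm_of_mem_maximalAtlas hφ (φ.map_source hu')).mdifferentiableAt (by simp)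
  have heq : (ψ.symm : V → M) =ᶠ[𝓝 u] φ.symm ∘ τ :=
    (eventually_mem_transition hu hu').mono fun w hw ↦ (φ.left_inv hw.2).symm
  have hd : (mfderiv (𝓡 n) (𝓡 n) ψ.symm u : V →L[ℝ] V) =
      (mfderiv (𝓡 n) (𝓡 n) φ.symm (τ u) : V →L[ℝ] V).comp (fderiv ℝ τ u) := by
    refine (heq.mfderiv_eq).trans ?_
    refine (mfderiv_comp u hφs hτ).trans ?_
    rw [mfderiv_eq_fderiv]
    rfl
  have ha : a (φ.symm (τ u)) = a (ψ.symm u) := congrArg a (φ.left_inv hu')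
  change (a (ψ.symm u)).compContinuousLinearMap (mfderiv (𝓡 n) (𝓡 n) ψ.symm u : V →L[ℝ] V) =
    ((a (φ.symm (τ u))).compContinuousLinearMap
      (mfderiv (𝓡 n) (𝓡 n) φ.symm (τ u) : V →L[ℝ] V)).compContinuousLinearMap (fderiv ℝ τ u)
  rw [hd, ha]
  rfl

theorem inChart_ne_zero {p : ℕ} {α : Form n M p}
    (hφ : φ ∈ IsManifold.maximalAtlas (𝓡 n) ∞ M) {x : M} (hx : x ∈ φ.source) (h0 : α x ≠ 0) :
    inChart α φ (φ x) ≠ 0 := by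
  let V := EuclideanSpace ℝ (Fin n)
  let a : M → V [⋀^Fin p]→L[ℝ] ℝ := α
  intro h
  refine h0 ?_
  let B : V →L[ℝ] V := mfderiv (𝓡 n) (𝓡 n) φ x
  let B' : V →L[ℝ] V := mfderiv (𝓡 n) (𝓡 n) φ.symm (φ x)
  have hBB : B'.comp B = ContinuousLinearMap.id ℝ V :=
    (mdifferentiable_of_mem_maximalAtlas hφ).symm_comp_deriv hx
  have h1 : (a (φ.symm (φ x))).compContinuousLinearMap B' = 0 := h
  rw [φ.left_inv hx] at h1
  have h2 : ((a x).compContinuousLinearMap B').compContinuousLinearMap B = 0 := by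
    rw [h1]
    rfl
  change (a x).compContinuousLinearMap (B'.comp B) = 0 at h2
  rw [hBB] at h2
  exact h2

/-- The exterior derivatives of the local expressions of a form in two charts are related by the
transition map. -/
theorem extDeriv_inChart_eq_comp {p : ℕ} {α : Form n M p} (hα : IsSmooth α)
    (hφ : φ ∈ IsManifold.maximalAtlas (𝓡 n) ∞ M) (hψ : ψ ∈ IsManifold.maximalAtlas (𝓡 n) ∞ M)
    {u : EuclideanSpace ℝ (Fin n)} (hu : u ∈ ψ.target) (hu' : ψ.symm u ∈ φ.source) :
    _root_.extDeriv (inChart α ψ) u =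
      (_root_.extDeriv (inChart α φ) (φ (ψ.symm u))).compContinuousLinearMap
        (fderiv ℝ (fun u ↦ φ (ψ.symm u)) u) := by
  have heq : inChart α ψ =ᶠ[𝓝 u] fun u ↦ (inChart α φ (φ (ψ.symm u))).compContinuousLinearMap
      (fderiv ℝ (fun u ↦ φ (ψ.symm u)) u) :=
    (eventually_mem_transition hu hu').mono fun w hw ↦ inChart_eq_comp α hφ hψ hw.1 hw.2
  rw [heq.extDeriv_eq]
  have hd : DifferentiableAt ℝ (inChart α φ) (φ (ψ.symm u)) :=
    ((hα φ hφ).contDiffAt (φ.open_target.mem_nhds (φ.map_source hu'))).differentiableAt (by simp)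
  exact extDeriv_pullback hd (contDiffAt_transition hφ hψ hu hu')
    (by simpa using WithTop.coe_le_coe.2 (le_top : (2 : ℕ∞) ≤ ⊤))

variable [IsManifold (𝓡 n) ∞ M]

/-- The preferred chart defining `extDeriv α y` varies with `y`; closedness near a point has to be
read in one fixed chart. Transition maps pull zero back to zero both ways, and the derivative of a
chart is invertible. -/
theorem extDeriv_eq_zero_iff {p : ℕ} {α : Form n M p} (hα : IsSmooth α)
    (hφ : φ ∈ IsManifold.maximalAtlas (𝓡 n) ∞ M) {y : M} (hy : y ∈ φ.source) :
    extDeriv α y = 0 ↔ _root_.extDeriv (inChart α φ) (φ y) = 0 := by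
  let V := EuclideanSpace ℝ (Fin n)
  set ψ := chartAt V y
  have hψ : ψ ∈ IsManifold.maximalAtlas (𝓡 n) ∞ M := IsManifold.chart_mem_maximalAtlas y
  have hyψ : y ∈ ψ.source := mem_chart_source V y
  have h1 := extDeriv_inChart_eq_comp hα hφ hψ (ψ.map_source hyψ) (by rwa [ψ.left_inv hyψ])
  have h2 := extDeriv_inChart_eq_comp hα hψ hφ (φ.map_source hy) (by rwa [φ.left_inv hy])
  rw [ψ.left_inv hyψ] at h1
  rw [φ.left_inv hy] at h2
  constructor
  · intro h
    suffices h3 : _root_.extDeriv (inChart α ψ) (ψ y) = 0 by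
      rw [h2, h3]
      rfl
    let B : V →L[ℝ] V := mfderiv (𝓡 n) (𝓡 n) ψ y
    let B' : V →L[ℝ] V := mfderiv (𝓡 n) (𝓡 n) ψ.symm (ψ y)
    have hBB : B.comp B' = ContinuousLinearMap.id ℝ V := by
      have := (mdifferentiable_of_mem_maximalAtlas hψ).comp_symm_deriv (ψ.map_source hyψ)
      rwa [ψ.left_inv hyψ] at this
    have h3 : (_root_.extDeriv (inChart α ψ) (ψ y)).compContinuousLinearMap B = 0 := h
    have h4 : ((_root_.extDeriv (inChart α ψ) (ψ y)).compContinuousLinearMap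
        B).compContinuousLinearMap B' = 0 := by
      rw [h3]
      rfl
    change (_root_.extDeriv (inChart α ψ) (ψ y)).compContinuousLinearMap (B.comp B') = 0 at h4
    rwa [hBB] at h4
  · intro h
    have h3 : _root_.extDeriv (inChart α ψ) (ψ y) = 0 := by
      rw [h1, h]
      rfl
    change (_root_.extDeriv (inChart α ψ) (ψ y)).compContinuousLinearMap
      (mfderiv (𝓡 n) (𝓡 n) ψ y : V →L[ℝ] V) = 0
    rw [h3]
    rfl

/-- A form with constant coefficients is closed. -/
theorem HasConstCoeffNear.isClosedNear {p : ℕ} {α : Form n M p} (hα : IsSmooth α) {x : M}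
    (h : HasConstCoeffNear α x) : IsClosedNear α x := by
  obtain ⟨φ, hφ, hx, -, hc⟩ := h
  have hconst : ∀ u ∈ φ.target, inChart α φ u = inChart α φ (φ x) := fun u hu ↦
    ContinuousAlternatingMap.ext_orderEmbedding fun I ↦ by
      obtain ⟨c, hc⟩ := hc I
      exact (hc u hu).trans (hc _ (φ.map_source hx)).symm
  filter_upwards [φ.open_source.mem_nhds hx] with y hy
  rw [extDeriv_eq_zero_iff hα hφ hy]
  have heq : inChart α φ =ᶠ[𝓝 (φ y)] fun _ ↦ inChart α φ (φ x) :=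
    Filter.eventuallyEq_of_mem (φ.open_target.mem_nhds (φ.map_source hy)) hconst
  rw [heq.extDeriv_eq, _root_.extDeriv, fderiv_fun_const]
  ext v
  simp [ContinuousAlternatingMap.alternatizeUncurryFin_apply]

/-- Composing a chart of a smooth manifold with a diffeomorphism between open sets of Euclidean
space gives a chart. -/
theorem trans_mem_maximalAtlas (hφ : φ ∈ IsManifold.maximalAtlas (𝓡 n) ∞ M)
    {e : OpenPartialHomeomorph (EuclideanSpace ℝ (Fin n)) (EuclideanSpace ℝ (Fin n))}
    (he : ∀ u ∈ e.source, ContDiffAt ℝ ∞ e u) (he' : ∀ w ∈ e.target, ContDiffAt ℝ ∞ e.symm w) :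
    φ.trans e ∈ IsManifold.maximalAtlas (𝓡 n) ∞ M := by
  refine OpenPartialHomeomorph.mem_maximalAtlas_of_contMDiffOn _ (fun y hy ↦ ?_) fun w hw ↦ ?_
  · rw [OpenPartialHomeomorph.trans_source] at hy
    exact ((he _ hy.2).contMDiffAt.comp y
      (contMDiffAt_of_mem_maximalAtlas hφ hy.1)).contMDiffWithinAt
  · rw [OpenPartialHomeomorph.trans_target] at hw
    exact ((contMDiffAt_symm_of_mem_maximalAtlas hφ hw.2).comp w
      (he' _ hw.1).contMDiffAt).contMDiffWithinAt

end Charts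

/-- Near a point where it does not vanish, a closed form of codegree one has constant coefficients
in suitable coordinates. -/
theorem IsClosedNear.hasConstCoeffNear {m : ℕ} {M : Type*} [TopologicalSpace M]
    [ChartedSpace (EuclideanSpace ℝ (Fin (m + 1))) M] [IsManifold (𝓡 (m + 1)) ∞ M]
    {α : Form (m + 1) M m} (hα : IsSmooth α) {x : M} (hx : α x ≠ 0) (h : IsClosedNear α x) :
    HasConstCoeffNear α x := by
  let V := EuclideanSpace ℝ (Fin (m + 1))
  set φ₀ := chartAt V x
  have hφ₀ : φ₀ ∈ IsManifold.maximalAtlas (𝓡 (m + 1)) ∞ M := IsManifold.chart_mem_maximalAtlas x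
  have hxs : x ∈ φ₀.source := mem_chart_source V x
  have hxt : φ₀ x ∈ φ₀.target := φ₀.map_source hxs
  have htarget := φ₀.open_target.mem_nhds hxt
  have hsmooth : ∀ᶠ u in 𝓝 (φ₀ x), ContDiffAt ℝ ∞ (inChart α φ₀) u := by
    filter_upwards [htarget] with u hu
    exact (hα φ₀ hφ₀).contDiffAt (φ₀.open_target.mem_nhds hu)
  have hclosed : ∀ᶠ u in 𝓝 (φ₀ x), _root_.extDeriv (inChart α φ₀) u = 0 := by
    have hc := φ₀.continuousAt_symm hxt
    rw [ContinuousAt, φ₀.left_inv hxs] at hc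
    filter_upwards [htarget, hc.eventually h] with u hu hu'
    have h1 := (extDeriv_eq_zero_iff hα hφ₀ (φ₀.map_target hu)).1 hu'
    rwa [φ₀.right_inv hu] at h1
  obtain ⟨f, c, hf0, hf, ⟨A, hA⟩, hc⟩ := EuclideanSpace.exists_pullback_const_eq hsmooth hclosed
    (inChart_ne_zero hφ₀ hxs hx)
  obtain ⟨e, he, hxe, heU, hes⟩ := exists_openPartialHomeomorph_of_contDiffAt
    (hf.and hc) (fun u hu ↦ hu.1) A hA
  have hφ : φ₀.trans e ∈ IsManifold.maximalAtlas (𝓡 (m + 1)) ∞ M :=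
    trans_mem_maximalAtlas hφ₀ (fun u hu ↦ by rw [he]; exact (heU hu).1) hes
  refine ⟨φ₀.trans e, hφ, ?_, ?_, ?_⟩
  · rw [OpenPartialHomeomorph.trans_source]
    exact ⟨hxs, hxe⟩
  · change e (φ₀ x) = 0
    rw [he, hf0]
  · refine fun I ↦ ⟨c fun k ↦ EuclideanSpace.single (I k) 1, fun u hu ↦ ?_⟩
    -- The local expression in `φ₀` is `f^* c` and `e` is a restriction of `f`, so passing to the
    -- coordinates `e ∘ φ₀` leaves `c`.
    have key : inChart α (φ₀.trans e) u = c := by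
      have hu0 := hu
      rw [OpenPartialHomeomorph.trans_target] at hu
      obtain ⟨hue, hu'⟩ := hu
      have hφu : φ₀ (φ₀.symm (e.symm u)) = e.symm u := φ₀.right_inv hu'
      have h1 := inChart_eq_comp α hφ₀ hφ hu0 (φ₀.map_target hu')
      have heq : (fun u ↦ φ₀ ((φ₀.trans e).symm u)) =ᶠ[𝓝 u] e.symm := by
        filter_upwards [(φ₀.trans e).open_target.mem_nhds hu0] with w hw
        rw [OpenPartialHomeomorph.trans_target] at hw
        exact φ₀.right_inv hw.2
      obtain ⟨hfu, hcu⟩ := heU (e.map_target hue)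
      rw [heq.fderiv_eq] at h1
      change _ = (inChart α φ₀ (φ₀ (φ₀.symm (e.symm u)))).compContinuousLinearMap _ at h1
      rw [hφu, ← hcu] at h1
      have h2 : HasFDerivAt (fun w ↦ f (e.symm w)) _ u :=
        (hfu.differentiableAt (by simp)).hasFDerivAt.comp u
          ((hes u hue).differentiableAt (by simp)).hasFDerivAt
      have h3 : HasFDerivAt (fun w ↦ f (e.symm w)) (ContinuousLinearMap.id ℝ V) u := by
        refine (hasFDerivAt_id u).congr_of_eventuallyEq ?_
        filter_upwards [e.open_target.mem_nhds hue] with w hw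
        rw [← he]
        exact e.right_inv hw
      change _ = c.compContinuousLinearMap ((fderiv ℝ f (e.symm u)).comp (fderiv ℝ e.symm u)) at h1
      rw [h2.unique h3] at h1
      exact h1
    rw [← key]
    rfl

end DiffForm

theorem mainTheorem9 (m : ℕ) {M : Type*} [TopologicalSpace M]
    [ChartedSpace (EuclideanSpace ℝ (Fin (m + 1))) M] [IsManifold (𝓡 (m + 1)) ∞ M]
    (α : DiffForm.Form (m + 1) M m) (hα : DiffForm.IsSmooth α) (x : M) (hx : α x ≠ 0) :
    DiffForm.HasConstCoeffNear α x ↔ DiffForm.IsClosedNear α x :=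
  ⟨fun h ↦ h.isClosedNear hα, fun h ↦ h.hasConstCoeffNear hα hx⟩
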